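/- Let $\Omega\subset\mathbb{R}^3$ be a bounded open set (in particular, any smoothly bounded domain), let $1<r<\infty$, and let $\|\cdot\|_r$ denote the norm of $L^r(\Omega)$. For a real-valued function $v$ on $\Omega$ and $1<q<5$ put $$\phi_v(x)=\int_\Omega\frac{v(y)^2}{|x-y|}\,dy\quad(x\in\mathbb{R}^3),$$ $$F_1(v)=\phi_v\,v,\qquad F_2(v)=|v|^{q-1}v+\phi_v\,v,\qquad F_3(v)=|v|^{q-1}v-\phi_v\,v .$$ (a) There is a constant $C>0$, depending only on $\Omega$ and $r$, such that for every $v\in L^{3r}(\Omega)$ the integral defining $\phi_v(x)$ converges for every $x\in\mathbb{R}^3$, $F_1(v)\in L^r(\Omega)$, and $$\|F_1(v)\|_r\le C\,\big\||v|^3\big\|_r .$$ (b) Let $1<q<5$ and $\kappa=\max\{q,3\}$. There is a constant $C>0$, depending only on $\Omega$, $r$ and $q$, such that for every $v\in L^{\kappa r}(\Omega)$ the integral defining $\phi_v(x)$ converges for every $x\in\mathbb{R}^3$, and for $i=2,3$, $F_i(v)\in L^r(\Omega)$ and $$\|F_i(v)\|_r\le C\big(1+\big\||v|^\kappa\big\|_r\big).$$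 -/

import Mathlib

open MeasureTheory

noncomputable section

/-- Three-dimensional Euclidean space. -/
abbrev Space3 : Type := EuclideanSpace ℝ (Fin 3)

/-- The integrand `y ↦ u(y)² / |x - y|` of the Newtonian potential at `x`. -/
def newtonIntegrand (u : Space3 → ℝ) (x y : Space3) : ℝ := 1 / ‖x - y‖ * u y ^ 2

/-- The Newtonian nonlocal term `φ_u(x) = ∫_Ω u(y)² / |x - y| dy`, for `x ∈ ℝ³`. -/
def newtonTerm (Ω : Set Space3) (u : Space3 → ℝ) (x : Space3) : ℝ :=
  ∫ y in Ω, newtonIntegrand u x y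

/-- `F₁(u) = φ_u u`. -/
def nonlinF1 (Ω : Set Space3) (u : Space3 → ℝ) (x : Space3) : ℝ :=
  newtonTerm Ω u x * u x

/-- `F₂(u) = |u|^{q-1} u + φ_u u`. -/
def nonlinF2 (Ω : Set Space3) (q : ℝ) (u : Space3 → ℝ) (x : Space3) : ℝ :=
  |u x| ^ (q - 1) * u x + newtonTerm Ω u x * u x

/-- `F₃(u) = |u|^{q-1} u - φ_u u`. -/
def nonlinF3 (Ω : Set Space3) (q : ℝ) (u : Space3 → ℝ) (x : Space3) : ℝ :=
  |u x| ^ (q - 1) * u x - newtonTerm Ω u x * u x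

/-- The `L^r(Ω)` norm, as an extended nonnegative number. -/
def normOn (Ω : Set Space3) (r : ℝ) (f : Space3 → ℝ) : ENNReal :=
  eLpNorm f (ENNReal.ofReal r) (volume.restrict Ω)

/-- `f ∈ L^r(Ω)`. -/
def InLp (Ω : Set Space3) (r : ℝ) (f : Space3 → ℝ) : Prop :=
  MemLp f (ENNReal.ofReal r) (volume.restrict Ω)

end

/-! Apply Hölder to `φ_v` with `v²` in `L^{3r/2}` and the kernel in `L^s`, `s` conjugate to `3r/2`.
Since `r > 1`, `s < 3`, so the kernel norm is bounded uniformly in `x`, and `|φ_v| ≤ K ‖v‖_{3r}²`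
everywhere (`exists_eLpNorm_newtonIntegrand_le`). Hence `‖φ_v v‖_r ≤ K ‖v‖_{3r}² ‖v‖_r`, and `L^{3r}
⊂ L^r` on the bounded set gives the cubic bound. Part (b) follows from `|v|^t ≤ 1 + |v|^κ` for `t =
q` and `t = 3`. -/

/-- In dimension three, `‖·‖⁻¹` is in `L^s` near the origin when `s < 3`. -/
theorem memLp_indicator_ball_inv_norm {s : ℝ} (hs0 : 0 < s) (hs : s < 3) :
    MemLp ((Metric.ball (0 : Space3) 1).indicator fun z => 1 / ‖z‖) (ENNReal.ofReal s) volume := by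
  have hmeas : AEStronglyMeasurable (fun z : Space3 => 1 / ‖z‖) volume := by
    simp only [one_div]
    exact (measurable_norm.inv).aestronglyMeasurable
  rw [memLp_indicator_iff_restrict Metric.isOpen_ball.measurableSet,
    ← integrable_norm_rpow_iff hmeas.restrict (by simpa using hs0) ENNReal.ofReal_ne_top,
    ENNReal.toReal_ofReal hs0.le]
  refine integrableOn_ball_of_norm_le_rpow (C := 1) (α := s) (by simp) (by simpa using hs) ?_ ?_
  · refine Filter.Eventually.of_forall fun z => le_of_eq ?_
    have h : 0 ≤ (1 / ‖z‖) ^ s := by positivity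
    have h' : ‖1 / ‖z‖‖ = 1 / ‖z‖ := Real.norm_of_nonneg (by positivity)
    rw [h', Real.norm_of_nonneg h, one_div, Real.inv_rpow (norm_nonneg z),
      Real.rpow_neg (norm_nonneg z), one_mul]
  · simp only [one_div, norm_inv, norm_norm]
    exact ((measurable_norm.inv).pow_const s).aestronglyMeasurable

/-- The kernels `1 / ‖x - ·‖` are bounded in `L^s`, uniformly in `x`, on sets of finite measure. -/
theorem exists_eLpNorm_newtonKernel_le (μ : Measure Space3) [IsFiniteMeasure μ] (hμ : μ ≤ volume)
    {s : ℝ} (hs1 : 1 ≤ s) (hs : s < 3) :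
    ∃ K : ENNReal, K ≠ ⊤ ∧
      ∀ x : Space3, eLpNorm (fun y => 1 / ‖x - y‖) (ENNReal.ofReal s) μ ≤ K := by
  set k : Space3 → ℝ := (Metric.ball (0 : Space3) 1).indicator fun z => 1 / ‖z‖ with hk
  have hkLp : MemLp k (ENNReal.ofReal s) volume :=
    memLp_indicator_ball_inv_norm (by linarith) hs
  -- The singular part is measured on all of space, so translation invariance removes `x`; outside
  -- the unit ball the kernel is at most `1`.
  refine ⟨eLpNorm k (ENNReal.ofReal s) volume + eLpNorm (fun _ : Space3 => (1 : ℝ))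
    (ENNReal.ofReal s) μ, ENNReal.add_ne_top.2 ⟨hkLp.eLpNorm_ne_top,
      (memLp_const (1 : ℝ)).eLpNorm_ne_top⟩, fun x => ?_⟩
  have hmp := Measure.measurePreserving_sub_left (volume : Measure Space3) x
  have hkx : MemLp (k ∘ fun y => x - y) (ENNReal.ofReal s) volume :=
    hkLp.comp_measurePreserving hmp
  calc eLpNorm (fun y => 1 / ‖x - y‖) (ENNReal.ofReal s) μ
      ≤ eLpNorm ((k ∘ fun y => x - y) + fun _ => (1 : ℝ)) (ENNReal.ofReal s) μ := by
        refine eLpNorm_mono_real fun y => ?_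
        have h : 0 ≤ 1 / ‖x - y‖ := by positivity
        rw [Real.norm_of_nonneg h, Pi.add_apply, Function.comp_apply, hk]
        by_cases hy : x - y ∈ Metric.ball (0 : Space3) 1
        · rw [Set.indicator_of_mem hy]
          linarith
        · rw [Set.indicator_of_notMem hy, zero_add]
          rw [mem_ball_zero_iff, not_lt] at hy
          exact div_le_one_of_le₀ hy (norm_nonneg _)
    _ ≤ eLpNorm (k ∘ fun y => x - y) (ENNReal.ofReal s) μ
          + eLpNorm (fun _ => (1 : ℝ)) (ENNReal.ofReal s) μ :=
        eLpNorm_add_le (hkx.1.mono_measure hμ) aestronglyMeasurable_const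
          (by simpa using hs1)
    _ ≤ _ := by
        gcongr
        rw [← eLpNorm_comp_measurePreserving (p := ENNReal.ofReal s) hkLp.1 hmp]
        exact eLpNorm_mono_measure _ hμ

theorem eLpNorm_abs_rpow {α : Type*} [MeasurableSpace α] (μ : Measure α) (v : α → ℝ) {r t : ℝ}
    (hr : 0 ≤ r) (ht : 0 < t) :
    eLpNorm (fun x => |v x| ^ t) (ENNReal.ofReal r) μ
      = eLpNorm v (ENNReal.ofReal (t * r)) μ ^ t := by
  have h := eLpNorm_norm_rpow (p := ENNReal.ofReal r) (μ := μ) v ht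
  simp only [Real.norm_eq_abs] at h
  rw [h, ← ENNReal.ofReal_mul hr, mul_comm]

theorem eLpNorm_abs_pow {α : Type*} [MeasurableSpace α] (μ : Measure α) (v : α → ℝ) {r : ℝ}
    (hr : 0 ≤ r) {n : ℕ} (hn : 0 < n) :
    eLpNorm (fun x => |v x| ^ n) (ENNReal.ofReal r) μ
      = eLpNorm v (ENNReal.ofReal (n * r)) μ ^ n := by
  have h := eLpNorm_abs_rpow μ v hr (Nat.cast_pos.2 hn)
  simpa only [Real.rpow_natCast, ENNReal.rpow_natCast] using h

theorem memLp_abs_rpow {α : Type*} [MeasurableSpace α] {μ : Measure α} {v : α → ℝ} {r t : ℝ}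
    (hr : 0 ≤ r) (ht : 0 < t) (hv : MemLp v (ENNReal.ofReal (t * r)) μ) :
    MemLp (fun x => |v x| ^ t) (ENNReal.ofReal r) μ := by
  refine ⟨(hv.1.norm.aemeasurable.pow_const t).aestronglyMeasurable, ?_⟩
  rw [eLpNorm_abs_rpow μ v hr ht]
  exact ENNReal.rpow_lt_top_of_nonneg ht.le hv.eLpNorm_ne_top

/-- Uniform control of the Newtonian integrand for densities in `L^{3r}`, `r > 1`. -/
theorem exists_eLpNorm_newtonIntegrand_le (μ : Measure Space3) [IsFiniteMeasure μ]
    (hμ : μ ≤ volume) {r : ℝ} (hr : 1 < r) :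
    ∃ K : ENNReal, K ≠ ⊤ ∧ ∀ v : Space3 → ℝ, MemLp v (ENNReal.ofReal (3 * r)) μ → ∀ x : Space3,
      Integrable (newtonIntegrand v x) μ ∧
      eLpNorm (newtonIntegrand v x) 1 μ ≤ K * eLpNorm v (ENNReal.ofReal (3 * r)) μ ^ 2 := by
  have ht : 1 < 3 * r / 2 := by linarith
  have hconj := Real.HolderConjugate.conjExponent ht
  set s : ℝ := (3 * r / 2).conjExponent with hs
  -- `s = 3r/(3r - 2)`, and this is below `3` exactly when `r > 1`.
  have hs3 : s < 3 := by
    rw [hs, Real.conjExponent, div_lt_iff₀ (by linarith)]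
    linarith
  have := hconj.symm.ennrealOfReal
  obtain ⟨K, hK, hKle⟩ := exists_eLpNorm_newtonKernel_le μ hμ hconj.symm.lt.le hs3
  refine ⟨K, hK, fun v hv x => ?_⟩
  have hkm : AEStronglyMeasurable (fun y => 1 / ‖x - y‖) μ := by
    simp only [one_div]
    exact ((measurable_const.sub measurable_id).norm.inv).aestronglyMeasurable
  have hv2 : eLpNorm (fun y => v y ^ 2) (ENNReal.ofReal (3 * r / 2)) μ
      = eLpNorm v (ENNReal.ofReal (3 * r)) μ ^ 2 := by
    have h := eLpNorm_abs_pow μ v (r := 3 * r / 2) (by linarith) (n := 2) two_pos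
    simp only [sq_abs] at h
    rw [h]
    congr 3
    push_cast
    ring
  have hv2m : AEStronglyMeasurable (fun y => v y ^ 2) μ := hv.1.pow 2
  have hle : eLpNorm (newtonIntegrand v x) 1 μ
      ≤ K * eLpNorm v (ENNReal.ofReal (3 * r)) μ ^ 2 := by
    refine (eLpNorm_smul_le_mul_eLpNorm (p := ENNReal.ofReal s)
      (q := ENNReal.ofReal (3 * r / 2)) (r := 1) hv2m hkm).trans ?_
    rw [hv2]
    gcongr
    exact hKle x
  refine ⟨memLp_one_iff_integrable.1 ⟨hkm.mul hv2m, hle.trans_lt ?_⟩, hle⟩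
  exact ENNReal.mul_lt_top hK.lt_top (ENNReal.pow_lt_top hv.eLpNorm_lt_top)

/-- Replacing `v` by a measurable representative changes no value of the integral and makes the
integrand jointly measurable. -/
theorem aestronglyMeasurable_newtonTerm {Ω : Set Space3} {v : Space3 → ℝ}
    (hv : AEStronglyMeasurable v (volume.restrict Ω)) (μ : Measure Space3) :
    AEStronglyMeasurable (newtonTerm Ω v) μ := by
  have h : newtonTerm Ω v = fun x => ∫ y in Ω, newtonIntegrand (hv.mk v) x y := by
    funext x
    refine integral_congr_ae ?_
    filter_upwards [hv.ae_eq_mk] with y hy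
    rw [newtonIntegrand, newtonIntegrand, hy]
  rw [h]
  have hm : StronglyMeasurable fun p : Space3 × Space3 => newtonIntegrand (hv.mk v) p.1 p.2 := by
    simp only [newtonIntegrand, one_div]
    exact (((measurable_fst.sub measurable_snd).norm.inv).mul
      ((hv.stronglyMeasurable_mk.measurable.comp measurable_snd).pow_const 2)).stronglyMeasurable
  exact hm.integral_prod_right'.aestronglyMeasurable

/-- The cubic estimate for `F₁`. -/
theorem exists_normOn_nonlinF1_le {Ω : Set Space3} (hΩ : Bornology.IsBounded Ω) {r : ℝ}
    (hr : 1 < r) :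
    ∃ C : ℝ, 0 < C ∧ ∀ v : Space3 → ℝ, InLp Ω (3 * r) v →
      (∀ x : Space3, IntegrableOn (newtonIntegrand v x) Ω) ∧
      InLp Ω r (nonlinF1 Ω v) ∧
      normOn Ω r (nonlinF1 Ω v) ≤ ENNReal.ofReal C * normOn Ω r (fun x => |v x| ^ 3) := by
  have : IsFiniteMeasure (volume.restrict Ω) := isFiniteMeasure_restrict.2 hΩ.measure_lt_top.ne
  obtain ⟨K, hK, hKle⟩ :=
    exists_eLpNorm_newtonIntegrand_le (volume.restrict Ω) Measure.restrict_le_self hr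
  set e : ℝ := 1 / (ENNReal.ofReal r).toReal - 1 / (ENNReal.ofReal (3 * r)).toReal with he
  have he0 : 0 ≤ e := by
    rw [he, ENNReal.toReal_ofReal (by linarith), ENNReal.toReal_ofReal (by linarith), sub_nonneg]
    exact one_div_le_one_div_of_le (by linarith) (by linarith)
  set L : ENNReal := K * volume.restrict Ω Set.univ ^ e with hL
  have hLtop : L ≠ ⊤ :=
    ENNReal.mul_ne_top hK (ENNReal.rpow_ne_top_of_nonneg he0 (measure_ne_top _ _))
  -- The `+ 1` keeps the constant positive when `L = 0`, as for empty `Ω`.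
  refine ⟨L.toReal + 1, by positivity, fun v hv => ?_⟩
  set N : ENNReal := eLpNorm v (ENNReal.ofReal (3 * r)) (volume.restrict Ω) with hN
  have hNtop : N ≠ ⊤ := hv.eLpNorm_ne_top
  have hcube : normOn Ω r (fun x => |v x| ^ 3) = N ^ 3 := by
    have h := eLpNorm_abs_pow (volume.restrict Ω) v (r := r) (by linarith) (n := 3) three_pos
    simp only [Nat.cast_ofNat] at h
    exact h
  have hφ (x : Space3) : ‖newtonTerm Ω v x‖ₑ ≤ K * N ^ 2 := by
    refine (enorm_integral_le_lintegral_enorm _).trans ?_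
    rw [← eLpNorm_one_eq_lintegral_enorm]
    exact (hKle v hv x).2
  have hle : normOn Ω r (nonlinF1 Ω v) ≤ L * N ^ 3 := by
    calc normOn Ω r (nonlinF1 Ω v)
        ≤ (K * N ^ 2) * eLpNorm v (ENNReal.ofReal r) (volume.restrict Ω) := by
          refine eLpNorm_le_mul_eLpNorm_of_ae_le_mul'' _ hv.1
            (Filter.Eventually.of_forall fun x => ?_)
          rw [nonlinF1, enorm_mul]
          gcongr
          exact hφ x
      _ ≤ (K * N ^ 2) * (N * volume.restrict Ω Set.univ ^ e) := by
          gcongr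
          exact eLpNorm_le_eLpNorm_mul_rpow_measure_univ
            (ENNReal.ofReal_le_ofReal (by linarith)) hv.1
      _ = L * N ^ 3 := by rw [hL]; ring
  refine ⟨fun x => (hKle v hv x).1, ⟨(aestronglyMeasurable_newtonTerm hv.1 _).mul hv.1,
    hle.trans_lt (ENNReal.mul_lt_top hLtop.lt_top (ENNReal.pow_lt_top hNtop.lt_top))⟩, ?_⟩
  rw [hcube]
  refine hle.trans ?_
  gcongr
  exact (ENNReal.le_ofReal_iff_toReal_le hLtop (by positivity)).2 (by linarith)

/-- Lower powers are controlled by higher ones on a finite measure space. -/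
theorem exists_eLpNorm_abs_rpow_le {α : Type*} [MeasurableSpace α] (μ : Measure α)
    [IsFiniteMeasure μ] {r : ℝ} (hr : 1 ≤ r) :
    ∃ A : ℝ, 1 ≤ A ∧ ∀ (t κ : ℝ), 0 ≤ t → t ≤ κ → ∀ v : α → ℝ, AEStronglyMeasurable v μ →
      eLpNorm (fun x => |v x| ^ t) (ENNReal.ofReal r) μ
        ≤ ENNReal.ofReal A * (1 + eLpNorm (fun x => |v x| ^ κ) (ENNReal.ofReal r) μ) := by
  have htop : eLpNorm (fun _ : α => (1 : ℝ)) (ENNReal.ofReal r) μ ≠ ⊤ :=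
    (memLp_const (1 : ℝ)).eLpNorm_ne_top
  set m : ENNReal := eLpNorm (fun _ : α => (1 : ℝ)) (ENNReal.ofReal r) μ
  refine ⟨m.toReal + 1, by linarith [m.toReal_nonneg], fun t κ ht htκ v hv => ?_⟩
  have hm : m ≤ ENNReal.ofReal (m.toReal + 1) :=
    (ENNReal.le_ofReal_iff_toReal_le htop (by positivity)).2 (by linarith)
  have h1 : 1 ≤ ENNReal.ofReal (m.toReal + 1) := by
    rw [ENNReal.one_le_ofReal]
    linarith [m.toReal_nonneg]
  calc eLpNorm (fun x => |v x| ^ t) (ENNReal.ofReal r) μ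
      ≤ eLpNorm ((fun _ => (1 : ℝ)) + fun x => |v x| ^ κ) (ENNReal.ofReal r) μ := by
        refine eLpNorm_mono_real fun x => ?_
        have hx : 0 ≤ |v x| ^ t := by positivity
        have hx' : 0 ≤ |v x| ^ κ := by positivity
        rw [Real.norm_of_nonneg hx, Pi.add_apply]
        rcases le_total |v x| 1 with h | h
        · linarith [Real.rpow_le_one (abs_nonneg (v x)) h ht]
        · linarith [Real.rpow_le_rpow_of_exponent_le h htκ]
    _ ≤ m + eLpNorm (fun x => |v x| ^ κ) (ENNReal.ofReal r) μ :=
        eLpNorm_add_le aestronglyMeasurable_const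
          (hv.norm.aemeasurable.pow_const κ).aestronglyMeasurable (by simpa using hr)
    _ ≤ ENNReal.ofReal (m.toReal + 1) * 1 + ENNReal.ofReal (m.toReal + 1)
          * eLpNorm (fun x => |v x| ^ κ) (ENNReal.ofReal r) μ := by
        rw [mul_one]
        gcongr
        exact le_mul_of_one_le_left' h1
    _ = _ := by rw [mul_add]

/-- `q ≠ 0` is needed at `a = 0`, because `0 ^ 0 = 1`. -/
theorem norm_abs_rpow_sub_one_mul {q : ℝ} (hq : q ≠ 0) (a : ℝ) : ‖|a| ^ (q - 1) * a‖ = |a| ^ q := by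
  rcases eq_or_ne a 0 with rfl | ha
  · simp [Real.zero_rpow hq]
  · have h : 0 ≤ |a| ^ (q - 1) := by positivity
    rw [norm_mul, Real.norm_of_nonneg h, Real.norm_eq_abs, Real.rpow_sub_one (abs_ne_zero.2 ha)]
    field_simp

theorem mainTheorem6 (Ω : Set Space3) (hΩ_open : IsOpen Ω) (hΩ_bdd : Bornology.IsBounded Ω)
    (r : ℝ) (hr : 1 < r) :
    (∃ C : ℝ, 0 < C ∧ ∀ v : Space3 → ℝ, InLp Ω (3 * r) v →
      (∀ x : Space3, IntegrableOn (newtonIntegrand v x) Ω) ∧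
      InLp Ω r (nonlinF1 Ω v) ∧
      normOn Ω r (nonlinF1 Ω v) ≤ ENNReal.ofReal C * normOn Ω r (fun x => |v x| ^ 3)) ∧
    (∀ q : ℝ, 1 < q → q < 5 →
      ∃ C : ℝ, 0 < C ∧ ∀ v : Space3 → ℝ, InLp Ω (max q 3 * r) v →
        (∀ x : Space3, IntegrableOn (newtonIntegrand v x) Ω) ∧
        InLp Ω r (nonlinF2 Ω q v) ∧
        normOn Ω r (nonlinF2 Ω q v)
          ≤ ENNReal.ofReal C * (1 + normOn Ω r (fun x => |v x| ^ (max q 3))) ∧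
        InLp Ω r (nonlinF3 Ω q v) ∧
        normOn Ω r (nonlinF3 Ω q v)
          ≤ ENNReal.ofReal C * (1 + normOn Ω r (fun x => |v x| ^ (max q 3)))) := by
  have hF1 := exists_normOn_nonlinF1_le hΩ_bdd hr
  refine ⟨hF1, fun q hq1 _ => ?_⟩
  have : IsFiniteMeasure (volume.restrict Ω) :=
    isFiniteMeasure_restrict.2 hΩ_bdd.measure_lt_top.ne
  obtain ⟨C, hC, hF1⟩ := hF1
  obtain ⟨A, hA, hpow⟩ := exists_eLpNorm_abs_rpow_le (volume.restrict Ω) hr.le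
  -- `A` bounds the power term; `C * A` bounds `φ_v v` through its cubic estimate.
  refine ⟨A + C * A, by positivity, fun v hv => ?_⟩
  have hr1 : 1 ≤ ENNReal.ofReal r := by simpa using hr.le
  obtain ⟨hint, hmem, hle⟩ := hF1 v (hv.mono_exponent
    (ENNReal.ofReal_le_ofReal (mul_le_mul_of_nonneg_right (le_max_right q 3) (by linarith))))
  have hqLp : MemLp (fun x => |v x| ^ q) (ENNReal.ofReal r) (volume.restrict Ω) :=
    memLp_abs_rpow (by linarith) (by linarith) (hv.mono_exponent
      (ENNReal.ofReal_le_ofReal (mul_le_mul_of_nonneg_right (le_max_left q 3) (by linarith))))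
  have hnorm (x : Space3) : ‖|v x| ^ (q - 1) * v x‖ = ‖|v x| ^ q‖ := by
    have h : 0 ≤ |v x| ^ q := by positivity
    rw [norm_abs_rpow_sub_one_mul (by linarith), Real.norm_of_nonneg h]
  have hG : MemLp (fun x => |v x| ^ (q - 1) * v x) (ENNReal.ofReal r) (volume.restrict Ω) :=
    hqLp.of_le (((hv.1.norm.aemeasurable.pow_const (q - 1)).aestronglyMeasurable).mul hv.1)
      (Filter.Eventually.of_forall fun x => (hnorm x).le)
  set S : ENNReal := 1 + normOn Ω r (fun x => |v x| ^ (max q 3))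
  have hGle : eLpNorm (fun x => |v x| ^ (q - 1) * v x) (ENNReal.ofReal r) (volume.restrict Ω)
      ≤ ENNReal.ofReal A * S := by
    rw [eLpNorm_congr_norm_ae (Filter.Eventually.of_forall hnorm)]
    exact hpow q (max q 3) (by linarith) (le_max_left q 3) v hv.1
  have hF1le : eLpNorm (nonlinF1 Ω v) (ENNReal.ofReal r) (volume.restrict Ω)
      ≤ ENNReal.ofReal C * (ENNReal.ofReal A * S) := by
    refine hle.trans ?_
    gcongr
    -- The cast lets the real exponent become the natural power in the cubic estimate.
    have h := hpow ((3 : ℕ) : ℝ) (max q 3) (by norm_num) (by simp) v hv.1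
    simp only [Real.rpow_natCast] at h
    exact h
  have hsum : ENNReal.ofReal A * S + ENNReal.ofReal C * (ENNReal.ofReal A * S)
      = ENNReal.ofReal (A + C * A) * S := by
    rw [ENNReal.ofReal_add (by positivity) (by positivity), ENNReal.ofReal_mul hC.le, add_mul,
      mul_assoc]
  refine ⟨hint, hG.add hmem, ?_, hG.sub hmem, ?_⟩
  · exact (eLpNorm_add_le hG.1 hmem.1 hr1).trans ((add_le_add hGle hF1le).trans hsum.le)
  · exact (eLpNorm_sub_le hG.1 hmem.1 hr1).trans ((add_le_add hGle hF1le).trans hsum.le)
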